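/- All trees are finite. For a rooted tree $A$ with more than one vertex write $A=[T_1,\dots,T_k]$ ($k\ge 1$), where $T_1,\dots,T_k$ are the connected components of $A$ minus its root, each rooted at its vertex adjacent to the root of $A$; $\bullet$ denotes the one-vertex rooted tree. Let $\rho$ be a real-valued invariant of rooted trees (isomorphic rooted trees have equal values) such that 1. there is a symmetric function $f_\rho$ of an arbitrary number of real variables with $\rho([T_1,\dots,T_k])=f_\rho(\rho(T_1),\dots,\rho(T_k))$ for all rooted trees $T_1,\dots,T_k$, $k\ge 1$; 2. on tuples of values of $\rho$, the function $f_\rho$ is strictly increasing in each single variable, and strictly increasing under addition of further variables: $f_\rho(x_1,\dots,x_k)<f_\rho(x_1,\dots,x_k,x_{k+1})$ for $k\ge 1$; 3. $\rho(\bullet)<\rho(B)$ for every rooted tree $B$ with more than one vertex. If $v\neq w$ are leaves of a tree $H$, let $[L_1,\dots,L_k]\,vHw\,[R_1,\dots,R_\ell]$ ($k,\ell\ge 0$) denote the tree obtained from $H$ by joining $v$ by an edge to the root of each of the rooted trees $L_1,\dots,L_k$, and $w$ to the root of each of $R_1,\dots,R_\ell$. A tree $T$ is called $\rho$-exchange-extremal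 if, for every decomposition $T=[L_1,\dots,L_k]\,vHw\,[R_1,\dots,R_\ell]$, either $k\ge \ell$ and $\min_i\rho(L_i)\ge\max_j\rho(R_j)$, or $k\le \ell$ and $\max_i\rho(L_i)\le\min_j\rho(R_j)$ (where $\min\emptyset=+\infty$ and $\max\emptyset=-\infty$). For the degree sequence $D=(d_0\ge d_1\ge\dots\ge d_{n-1})$ of a tree, the greedy tree $\mathcal G(D)$ is the tree with vertices $0,1,\dots,n-1$ constructed as follows: vertex $0$ is joined to the vertices $1,\dots,d_0$; then, for $i=1,2,\dots,n-1$ in this order, vertex $i$ is joined to the next $d_i-1$ vertices that have not been joined to any vertex yet. (So the vertices are labelled in breadth-first order, and the largest available degrees are assigned first.) Then every $\rho$-exchange-extremal tree $T$ is isomorphic to the greedy tree $\mathcal G(D)$, where $D$ is the degree sequence of $T$. -/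

import Mathlib

universe u

/-- The vertex set of the connected component of `G - r` that contains `u`: all vertices that can
be reached from `u` by a walk avoiding `r`. -/
def branchSet {V : Type u} (G : SimpleGraph V) (r u : V) : Set V :=
  {x | ∃ p : G.Walk u x, r ∉ p.support}

theorem mem_branchSet_self {V : Type u} {G : SimpleGraph V} {r u : V} (h : G.Adj r u) :
    u ∈ branchSet G r u :=
  ⟨SimpleGraph.Walk.nil, by simpa using h.ne⟩

theorem isTree_induce_branchSet {V : Type u} {G : SimpleGraph V} (hG : G.IsTree) {r u : V}
    (h : G.Adj r u) : (G.induce (branchSet G r u)).IsTree := by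
  refine ⟨?_, hG.isAcyclic.induce _⟩
  refine G.induce_connected_of_patches u (mem_branchSet_self h) ?_
  rintro x ⟨p, hp⟩
  refine ⟨{y | y ∈ p.support}, ?_, p.start_mem_support, p.end_mem_support,
    p.connected_induce_support _ _⟩
  intro y hy
  classical
  exact ⟨p.takeUntil y hy, fun hr => hp (p.support_takeUntil_subset_support hy hr)⟩

/-- A finite rooted tree. -/
structure FinRootedTree : Type (u + 1) where
  V : Type u
  [finite : Finite V]
  graph : SimpleGraph V
  isTree : graph.IsTree
  root : V

attribute [instance] FinRootedTree.finite

/-- The branch of the tree `G` at the vertex `r` through its neighbour `u`: the component of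
`G - r` that contains `u`, rooted at `u`. -/
def branch {V : Type u} [Finite V] {G : SimpleGraph V} (hG : G.IsTree) {r u : V}
    (h : G.Adj r u) : FinRootedTree.{u} where
  V := branchSet G r u
  graph := G.induce (branchSet G r u)
  isTree := isTree_induce_branchSet hG h
  root := ⟨u, mem_branchSet_self h⟩

/-- `ρ` is an invariant of rooted trees: it does not distinguish isomorphic rooted trees. -/
def IsRootedTreeInvariant (ρ : FinRootedTree.{u} → ℝ) : Prop :=
  ∀ (A B : FinRootedTree.{u}) (e : A.graph ≃g B.graph), e A.root = B.root → ρ A = ρ B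

open Classical in
/-- The multiset `{ρ(T₁), …, ρ(T_k)}` for the rooted tree `A = [T₁, …, T_k]`, where `T₁, …, T_k` are
the components of `A` minus its root, rooted at the neighbours of the root of `A`. -/
noncomputable def branchValues (ρ : FinRootedTree.{u} → ℝ) (A : FinRootedTree.{u}) : Multiset ℝ :=
  letI := Fintype.ofFinite (A.graph.neighborSet A.root)
  (Finset.univ : Finset (A.graph.neighborSet A.root)).val.map fun x => ρ (branch A.isTree x.2)

/-- `ρ([T₁, …, T_k]) = f(ρ(T₁), …, ρ(T_k))` for all rooted trees with more than one vertex.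
A symmetric function of an arbitrary number of variables is a function of multisets. -/
def HasRecurrenceRule (ρ : FinRootedTree.{u} → ℝ) (f : Multiset ℝ → ℝ) : Prop :=
  ∀ A : FinRootedTree.{u}, 1 < Nat.card A.V → ρ A = f (branchValues ρ A)

/-- `f` is strictly increasing in each variable and under addition of further variables, where the
variables range over the values of `ρ`. -/
structure IsStrictlyIncreasingRule (ρ : FinRootedTree.{u} → ℝ) (f : Multiset ℝ → ℝ) : Prop where
  lt_of_lt : ∀ s : Multiset ℝ, (∀ x ∈ s, x ∈ Set.range ρ) →
    ∀ a ∈ Set.range ρ, ∀ b ∈ Set.range ρ, a < b → f (a ::ₘ s) < f (b ::ₘ s)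
  lt_cons : ∀ s : Multiset ℝ, s ≠ 0 → (∀ x ∈ s, x ∈ Set.range ρ) →
    ∀ a ∈ Set.range ρ, f s < f (a ::ₘ s)

/-- The tree `T` is decomposed as `[L₁, …, L_k] v H w [R₁, …, R_l]`, where `H` is the subgraph of `T`
induced by the vertex set `S`: `H` is a tree, `v` and `w` are distinct leaves of `H`, and the rest
of `T` is attached to `H` at `v` and `w` only. The `L_i` are then the branches of `T` at `v` through
the neighbours of `v` outside `S`, and the `R_j` are those at `w`. -/
structure IsExchangeDecomposition {V : Type u} (T : SimpleGraph V) (S : Set V) (v w : V) :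
    Prop where
  isTree : (T.induce S).IsTree
  left_mem : v ∈ S
  right_mem : w ∈ S
  ne : v ≠ w
  left_leaf : ∃! x, x ∈ S ∧ T.Adj v x
  right_leaf : ∃! x, x ∈ S ∧ T.Adj w x
  attached : ∀ x ∈ S, ∀ y ∉ S, T.Adj x y → x = v ∨ x = w

/-- The neighbours of `v` outside `S`. -/
def outerNeighbors {V : Type u} (T : SimpleGraph V) (S : Set V) (v : V) : Set V :=
  {x | T.Adj v x ∧ x ∉ S}

/-- `T` is `ρ`-exchange-extremal: for every decomposition `[L₁, …, L_k] v H w [R₁, …, R_l]` of `T`,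
either `k ≥ l` and `min ρ(L_i) ≥ max ρ(R_j)`, or `k ≤ l` and `max ρ(L_i) ≤ min ρ(R_j)`
(inequalities with a minimum or maximum over the empty set count as true). -/
def IsExchangeExtremal {V : Type u} [Finite V] (ρ : FinRootedTree.{u} → ℝ) {T : SimpleGraph V}
    (hT : T.IsTree) : Prop :=
  ∀ (S : Set V) (v w : V), IsExchangeDecomposition T S v w →
    ((outerNeighbors T S w).ncard ≤ (outerNeighbors T S v).ncard ∧
      ∀ x (hx : x ∈ outerNeighbors T S v) y (hy : y ∈ outerNeighbors T S w),
        ρ (branch hT hy.1) ≤ ρ (branch hT hx.1)) ∨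
    ((outerNeighbors T S v).ncard ≤ (outerNeighbors T S w).ncard ∧
      ∀ x (hx : x ∈ outerNeighbors T S v) y (hy : y ∈ outerNeighbors T S w),
        ρ (branch hT hx.1) ≤ ρ (branch hT hy.1))

/-- The degree sequence of a finite graph, in non-increasing order. -/
def degreeSequence {V : Type u} [Fintype V] (T : SimpleGraph V) [DecidableRel T.Adj] : List ℕ :=
  (Finset.univ.val.map fun v => T.degree v).sort (· ≥ ·)

/-- The number of neighbours that vertex `i` still has to receive when it is processed in the greedy
construction: all `d₀` neighbours for the root `0`, all but the parent for every other vertex. -/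
def greedyChildCount (D : List ℕ) (i : ℕ) : ℕ :=
  if i = 0 then D.getD 0 0 else D.getD i 0 - 1

/-- The first label not yet in use when vertex `i` is processed in the greedy construction. -/
def greedyFirstChild (D : List ℕ) (i : ℕ) : ℕ :=
  1 + ∑ m ∈ Finset.range i, greedyChildCount D m

/-- The greedy tree `G(D)` of a non-increasing degree sequence `D = (d₀, d₁, …)` of a tree. Vertices
are labelled `0, 1, 2, …` in the order in which the greedy algorithm labels them, so that vertex `i`
is given the degree `d_i`, the largest one still available. The root is `0`; the vertices are
processed in the order of their labels, and the neighbours given to vertex `i` when it is processed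
are the next unused labels. -/
def greedyTree (D : List ℕ) : SimpleGraph (Fin D.length) :=
  SimpleGraph.fromRel fun i j =>
    greedyFirstChild D i ≤ (j : ℕ) ∧ (j : ℕ) < greedyFirstChild D (i + 1)

/-! For an edge `uv`, let `b u v` be the value of the branch at `u` through `v`, so that each edge
carries two values. Let `v`, `w` be distinct vertices with neighbours `v'`, `w'` towards each other.
Applied to the part of the tree between `v` and `w`, extremality compares the outer branches at `v`
and at `w` in number and in value, in one direction or the other. Since `f` is strictly increasing,
the direction is decided by `b v' v` and `b w' w`: if the outer branches at `w` dominate although `b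
w' w ≤ b v' v`, they also are dominated. This is `ExchangeOrdered`, and nothing else about `ρ` is
used afterwards.

Let an edge point towards its heavier side. Two edges leaving one vertex would start a path whose
ends dominate each other with a shift by one vertex, hence could be prolonged forever
(`false_of_shifted_paths`). Counting edges gives a vertex `r` with no edge strictly leaving it
(`exists_sink`); rooted at `r`, the tree has all its edges pointing upwards (`branch_le_of_sink`).

Exchange ordering then propagates down the tree. It starts from an upward edge when consecutive
levels are compared (`facing_of_depth_succ`), and from siblings when one level is sorted by parents
first and decreasing branch values second (`branch_le_of_levelRank_lt`). So degrees do not increase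
along this breadth-first order. Such an order determines the tree: the children of each vertex
occupy the interval of labels that the greedy construction assigns (`nonempty_iso_greedyTree`). -/

/-! ### Branches of a tree and the part between two vertices -/

section Branches

variable {V : Type u} {G : SimpleGraph V}

theorem notMem_branchSet (r u : V) : r ∉ branchSet G r u := by
  rintro ⟨p, hp⟩
  exact hp p.end_mem_support

theorem mem_branchSet_of_adj {r u x y : V} (hx : x ∈ branchSet G r u) (h : G.Adj x y)
    (hy : y ≠ r) : y ∈ branchSet G r u := by
  obtain ⟨p, hp⟩ := hx
  refine ⟨p.concat h, ?_⟩
  simp [SimpleGraph.Walk.support_concat, hp, hy.symm]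

theorem mem_branchSet_trans {r a b c : V} (hb : b ∈ branchSet G r a) (hc : c ∈ branchSet G r b) :
    c ∈ branchSet G r a := by
  obtain ⟨p, hp⟩ := hb
  obtain ⟨q, hq⟩ := hc
  refine ⟨p.append q, ?_⟩
  simp [SimpleGraph.Walk.mem_support_append_iff, hp, hq]

theorem mem_branchSet_symm {r a b : V} (hb : b ∈ branchSet G r a) : a ∈ branchSet G r b := by
  obtain ⟨p, hp⟩ := hb
  exact ⟨p.reverse, by simpa using hp⟩

/-- Distinct neighbours of a vertex of a forest lie in distinct branches. -/
theorem eq_of_mem_branchSet (hG : G.IsAcyclic) {r a b : V} (ha : G.Adj r a) (hb : G.Adj r b)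
    (h : b ∈ branchSet G r a) : a = b := by
  classical
  obtain ⟨p, hp⟩ := h
  have hp' : r ∉ p.toPath.1.support := fun hr => hp (p.support_toPath_subset_support hr)
  have hpath : (SimpleGraph.Walk.cons ha p.toPath.1).IsPath := p.toPath.2.cons hp'
  have := (hG.subsingleton_path r b).elim ⟨_, hpath⟩ (SimpleGraph.Path.singleton hb)
  have h2 := congrArg (fun q : G.Path r b => q.1.snd) this
  simpa [SimpleGraph.Path.singleton] using h2

theorem branchSet_subset (hG : G.IsAcyclic) {r u x : V} (hu : G.Adj r u) (hx : G.Adj u x)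
    (hxr : x ≠ r) : branchSet G u x ⊆ branchSet G r u := by
  classical
  rintro y ⟨p, hp⟩
  refine ⟨SimpleGraph.Walk.cons hx p, ?_⟩
  simp only [SimpleGraph.Walk.support_cons, List.mem_cons, not_or]
  refine ⟨hu.ne, fun hr => hxr ?_⟩
  exact eq_of_mem_branchSet hG hx hu.symm
    ⟨p.takeUntil r hr, fun h => hp (p.support_takeUntil_subset_support hr h)⟩

theorem branchSet_ssubset (hG : G.IsAcyclic) {r u x : V} (hu : G.Adj r u) (hx : G.Adj u x)
    (hxr : x ≠ r) : branchSet G u x ⊂ branchSet G r u :=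
  ⟨branchSet_subset hG hu hx hxr, fun h => notMem_branchSet u x (h (mem_branchSet_self hu))⟩

/-- `v'` is the neighbour of `v` in the direction of `w`, and `w'` is the neighbour of `w` in the
direction of `v`. -/
structure Facing (G : SimpleGraph V) (v v' w w' : V) : Prop where
  adj_left : G.Adj v v'
  adj_right : G.Adj w w'
  right_mem : w ∈ branchSet G v v'
  left_mem : v ∈ branchSet G w w'

namespace Facing

variable {v v' w w' : V}

theorem symm (h : Facing G v v' w w') : Facing G w w' v v' :=
  ⟨h.2, h.1, h.4, h.3⟩

theorem ne (h : Facing G v v' w w') : v ≠ w := by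
  rintro rfl
  exact notMem_branchSet _ _ h.right_mem

theorem of_adj (h : G.Adj v w) : Facing G v w w v :=
  ⟨h, h.symm, mem_branchSet_self h, mem_branchSet_self h.symm⟩

theorem of_common_neighbor {c : V} (hv : G.Adj c v) (hw : G.Adj c w) (hvw : v ≠ w) :
    Facing G v c w c :=
  ⟨hv.symm, hw.symm, mem_branchSet_of_adj (mem_branchSet_self hv.symm) hw hvw.symm,
    mem_branchSet_of_adj (mem_branchSet_self hw.symm) hv hvw⟩

theorem outer_right_mem (hG : G.IsAcyclic) (h : Facing G v v' w w') {x y : V} (hx : G.Adj v x)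
    (hxv : x ≠ v') (hy : G.Adj w y) : y ∈ branchSet G x v := by
  classical
  obtain ⟨p, hp⟩ := h.right_mem
  have hxp : x ∉ p.support := fun hxs => hxv
    (eq_of_mem_branchSet hG h.adj_left hx
      ⟨p.takeUntil x hxs, fun hs => hp (p.support_takeUntil_subset_support hxs hs)⟩).symm
  have hw : w ∈ branchSet G x v :=
    ⟨SimpleGraph.Walk.cons h.adj_left p, by simp [hxp, hx.ne']⟩
  refine mem_branchSet_of_adj hw hy ?_
  rintro rfl
  refine hxv (eq_of_mem_branchSet hG h.adj_left hx ?_).symm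
  exact mem_branchSet_of_adj h.right_mem hy hx.ne'

/-- Prolongs the path between `v` and `w` by one vertex at each end; the later inductions along
paths all proceed by this step. -/
theorem outer (hG : G.IsAcyclic) (h : Facing G v v' w w') {x y : V} (hx : G.Adj v x)
    (hxv : x ≠ v') (hy : G.Adj w y) (hyw : y ≠ w') : Facing G x v y w :=
  ⟨hx.symm, hy.symm, h.outer_right_mem hG hx hxv hy,
    h.symm.outer_right_mem hG hy hyw hx⟩

end Facing

/-- Paths in a forest are unique, so the given path is the one found inside `s`. -/
theorem support_subset_of_induce_preconnected (hG : G.IsAcyclic) {s : Set V}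
    (hs : (G.induce s).Preconnected) {x y : V} (hx : x ∈ s) (hy : y ∈ s) (p : G.Path x y) :
    ∀ z ∈ p.1.support, z ∈ s := by
  classical
  obtain ⟨q⟩ := hs ⟨x, hx⟩ ⟨y, hy⟩
  have hinj : Function.Injective (SimpleGraph.Embedding.induce (G := G) s).toHom :=
    Subtype.val_injective
  have := (hG.subsingleton_path x y).elim p
    ⟨q.toPath.1.map (SimpleGraph.Embedding.induce (G := G) s).toHom, q.toPath.2.map hinj⟩
  rw [this]
  intro z hz
  obtain ⟨a, -, rfl⟩ := List.mem_map.1 ((SimpleGraph.Walk.support_map _ _) ▸ hz)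
  exact a.2

theorem induce_inter_connected (hG : G.IsTree) {s t : Set V} (hs : (G.induce s).Preconnected)
    (ht : (G.induce t).Preconnected) {x : V} (hxs : x ∈ s) (hxt : x ∈ t) :
    (G.induce (s ∩ t)).Connected := by
  classical
  refine G.induce_connected_of_patches x ⟨hxs, hxt⟩ ?_
  rintro y ⟨hys, hyt⟩
  obtain ⟨p⟩ := hG.1.preconnected x y
  refine ⟨{z | z ∈ p.toPath.1.support}, fun z hz =>
    ⟨support_subset_of_induce_preconnected hG.isAcyclic hs hxs hys _ z hz,
      support_subset_of_induce_preconnected hG.isAcyclic ht hxt hyt _ z hz⟩,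
    p.toPath.1.start_mem_support, p.toPath.1.end_mem_support,
    p.toPath.1.connected_induce_support _ _⟩

theorem induce_insert_branchSet_connected {v v' : V} (h : G.Adj v v') :
    (G.induce (insert v (branchSet G v v'))).Connected := by
  classical
  refine G.induce_connected_of_patches v (Set.mem_insert _ _) ?_
  rintro y (rfl | ⟨p, hp⟩)
  · exact ⟨{y}, by simp, rfl, rfl, SimpleGraph.Reachable.refl _⟩
  · refine ⟨{z | z ∈ (SimpleGraph.Walk.cons h p).support}, ?_,
      SimpleGraph.Walk.start_mem_support _, SimpleGraph.Walk.end_mem_support _,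
      (SimpleGraph.Walk.cons h p).connected_induce_support _ _⟩
    intro z hz
    simp only [SimpleGraph.Walk.support_cons, List.mem_cons, Set.mem_ofPred_eq] at hz
    rcases hz with rfl | hz
    · exact Set.mem_insert _ _
    · exact Or.inr ⟨p.takeUntil z hz, fun hs => hp (p.support_takeUntil_subset_support hz hs)⟩

/-- The vertex set of the part of `G` between `v` and `w`, where `v'` and `w'` are the neighbours of
`v` and `w` in each other's direction. -/
def middleSet (G : SimpleGraph V) (v v' w w' : V) : Set V :=
  insert v (branchSet G v v') ∩ insert w (branchSet G w w')

theorem middleSet_comm (v v' w w' : V) : middleSet G v v' w w' = middleSet G w w' v v' :=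
  Set.inter_comm _ _

namespace Facing

variable {v v' w w' : V}

theorem left_mem_middleSet (h : Facing G v v' w w') : v ∈ middleSet G v v' w w' :=
  ⟨Set.mem_insert _ _, Or.inr h.left_mem⟩

theorem mem_middleSet_and_adj_iff (hG : G.IsAcyclic) (h : Facing G v v' w w') (x : V) :
    x ∈ middleSet G v v' w w' ∧ G.Adj v x ↔ x = v' := by
  constructor
  · rintro ⟨⟨rfl | hx, -⟩, hvx⟩
    · exact absurd rfl hvx.ne
    · exact (eq_of_mem_branchSet hG h.adj_left hvx hx).symm
  · rintro rfl
    refine ⟨⟨Or.inr (mem_branchSet_self h.adj_left), ?_⟩, h.adj_left⟩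
    by_cases hxw : x = w
    · exact Or.inl hxw
    · exact Or.inr (mem_branchSet_of_adj h.left_mem h.adj_left hxw)

theorem isExchangeDecomposition (hG : G.IsTree) (h : Facing G v v' w w') :
    IsExchangeDecomposition G (middleSet G v v' w w') v w where
  isTree := ⟨induce_inter_connected hG
      (induce_insert_branchSet_connected h.adj_left).preconnected
      (induce_insert_branchSet_connected h.adj_right).preconnected
      h.left_mem_middleSet.1 h.left_mem_middleSet.2, hG.isAcyclic.induce _⟩
  left_mem := h.left_mem_middleSet
  right_mem := by rw [middleSet_comm]; exact h.symm.left_mem_middleSet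
  ne := h.ne
  left_leaf := ⟨v', (h.mem_middleSet_and_adj_iff hG.isAcyclic v').2 rfl,
    fun x hx => (h.mem_middleSet_and_adj_iff hG.isAcyclic x).1 hx⟩
  right_leaf := by
    rw [middleSet_comm]
    exact ⟨w', (h.symm.mem_middleSet_and_adj_iff hG.isAcyclic w').2 rfl,
      fun x hx => (h.symm.mem_middleSet_and_adj_iff hG.isAcyclic x).1 hx⟩
  attached := by
    rintro x ⟨hx1, hx2⟩ y hy hxy
    by_contra! hne
    refine hy ⟨?_, ?_⟩
    · by_cases hyv : y = v
      · exact Or.inl hyv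
      · exact Or.inr (mem_branchSet_of_adj (hx1.resolve_left hne.1) hxy hyv)
    · by_cases hyw : y = w
      · exact Or.inl hyw
      · exact Or.inr (mem_branchSet_of_adj (hx2.resolve_left hne.2) hxy hyw)

theorem mem_outerNeighbors_iff (hG : G.IsAcyclic) (h : Facing G v v' w w') (x : V) :
    x ∈ outerNeighbors G (middleSet G v v' w w') v ↔ G.Adj v x ∧ x ≠ v' := by
  have := h.mem_middleSet_and_adj_iff hG x
  simp only [outerNeighbors, Set.mem_ofPred_eq]
  tauto

theorem ncard_outerNeighbors [Fintype V] [DecidableRel G.Adj] (hG : G.IsAcyclic)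
    (h : Facing G v v' w w') :
    (outerNeighbors G (middleSet G v v' w w') v).ncard + 1 = G.degree v := by
  classical
  have hs : outerNeighbors G (middleSet G v v' w w') v =
      ((G.neighborFinset v).erase v' : Finset V) := by
    ext x
    simp [h.mem_outerNeighbors_iff hG, and_comm]
  rw [hs, Set.ncard_coe_finset, Finset.card_erase_add_one (by simpa using h.adj_left),
    SimpleGraph.card_neighborFinset_eq_degree]

end Facing

end Branches

/-! ### The recurrence for branch values inside a fixed tree -/

section BranchValue

variable {V : Type u} {G : SimpleGraph V}

/-- A walk from `x` that avoids `u` cannot leave the branch at `r`. Hence a branch of a branch is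
again a branch of `G`, and the recurrence can be unfolded without leaving `G`. -/
theorem mem_branchSet_induce_iff (hG : G.IsAcyclic) {r u : V} (h : G.Adj r u)
    (x : (G.induce (branchSet G r u)).neighborSet ⟨u, mem_branchSet_self h⟩)
    (z : branchSet G r u) :
    z ∈ branchSet (G.induce (branchSet G r u)) ⟨u, mem_branchSet_self h⟩ x.1 ↔
      z.1 ∈ branchSet G u x.1.1 := by
  classical
  have hux : G.Adj u x.1.1 := x.2
  have hxr : x.1.1 ≠ r := by
    intro hx
    exact notMem_branchSet r u (hx ▸ x.1.2)
  constructor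
  · rintro ⟨p, hp⟩
    refine ⟨p.map (SimpleGraph.Embedding.induce (branchSet G r u)).toHom, fun hu => hp ?_⟩
    obtain ⟨a, ha, hau⟩ := List.mem_map.1 ((SimpleGraph.Walk.support_map _ _) ▸ hu)
    have : a = ⟨u, mem_branchSet_self h⟩ := Subtype.ext hau
    exact this ▸ ha
  · rintro ⟨p, hp⟩
    have hs : ∀ y ∈ p.support, y ∈ branchSet G r u := fun y hy =>
      branchSet_subset hG h hux hxr
        ⟨p.takeUntil y hy, fun hu => hp (p.support_takeUntil_subset_support hy hu)⟩
    refine ⟨p.induce _ hs, fun hu => hp ?_⟩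
    have := List.mem_map_of_mem (f := Subtype.val) hu
    simpa [SimpleGraph.Walk.support_induce] using this

variable [Fintype V]

open Classical in
/-- The value of `ρ` on the branch of `G` at `r` through its neighbour `u`. -/
noncomputable def branchValue (ρ : FinRootedTree.{u} → ℝ) (hG : G.IsTree) (r u : V) : ℝ :=
  if h : G.Adj r u then ρ (branch hG h) else 0

theorem branchValue_of_adj (ρ : FinRootedTree.{u} → ℝ) (hG : G.IsTree) {r u : V}
    (h : G.Adj r u) : branchValue ρ hG r u = ρ (branch hG h) := dif_pos h

theorem branchValue_mem_range (ρ : FinRootedTree.{u} → ℝ) (hG : G.IsTree) {r u : V}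
    (h : G.Adj r u) : branchValue ρ hG r u ∈ Set.range ρ :=
  ⟨_, (branchValue_of_adj ρ hG h).symm⟩

theorem branch_branch_value {ρ : FinRootedTree.{u} → ℝ} (hρ : IsRootedTreeInvariant ρ)
    (hG : G.IsTree) {r u : V} (h : G.Adj r u)
    (x : (branch hG h).graph.neighborSet (branch hG h).root) :
    ρ (branch (branch hG h).isTree x.2) = branchValue ρ hG u x.1.1 := by
  have hux : G.Adj u x.1.1 := x.2
  have hxr : x.1.1 ≠ r := by
    intro hx
    exact notMem_branchSet r u (hx ▸ x.1.2)
  rw [branchValue_of_adj ρ hG hux]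
  refine hρ _ _
    { toFun := fun z => ⟨z.1.1, (mem_branchSet_induce_iff hG.isAcyclic h x z.1).1 z.2⟩
      invFun := fun z => ⟨⟨z.1, branchSet_subset hG.isAcyclic h hux hxr z.2⟩,
        (mem_branchSet_induce_iff hG.isAcyclic h x _).2 z.2⟩
      left_inv := fun z => rfl
      right_inv := fun z => rfl
      map_rel_iff' := Iff.rfl } rfl

variable [DecidableEq V] [DecidableRel G.Adj]

/-- The values of `ρ` on the branches of `G` at `u`, except the one through `r`. -/
noncomputable def outerValues (ρ : FinRootedTree.{u} → ℝ) (hG : G.IsTree) (r u : V) :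
    Multiset ℝ :=
  ((G.neighborFinset u).erase r).val.map fun x => branchValue ρ hG u x

theorem branchValues_branch {ρ : FinRootedTree.{u} → ℝ} (hρ : IsRootedTreeInvariant ρ)
    (hG : G.IsTree) {r u : V} (h : G.Adj r u) :
    branchValues ρ (branch hG h) = outerValues ρ hG r u := by
  classical
  unfold branchValues outerValues
  let _ := Fintype.ofFinite ((branch hG h).graph.neighborSet (branch hG h).root)
  let g : (branch hG h).graph.neighborSet (branch hG h).root → V := fun x => x.1.1
  have hg : Function.Injective g := fun x y hxy => Subtype.ext (Subtype.ext hxy)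
  have hs : (Finset.univ.map ⟨g, hg⟩) = (G.neighborFinset u).erase r := by
    ext y
    simp only [Finset.mem_map, Finset.mem_univ, true_and, Function.Embedding.coeFn_mk,
      Finset.mem_erase, SimpleGraph.mem_neighborFinset]
    constructor
    · rintro ⟨x, rfl⟩
      have hx : g x ∈ branchSet G r u := x.1.2
      exact ⟨fun hxr => notMem_branchSet r u (hxr ▸ hx), x.2⟩
    · rintro ⟨hyr, huy⟩
      exact ⟨⟨⟨y, mem_branchSet_of_adj (mem_branchSet_self h) huy hyr⟩, huy⟩, rfl⟩
  rw [← hs, Finset.map_val, Multiset.map_map]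
  exact Multiset.map_congr rfl fun x _ => branch_branch_value hρ hG h x

theorem card_outerValues (ρ : FinRootedTree.{u} → ℝ) (hG : G.IsTree) {r u : V}
    (h : G.Adj r u) : (outerValues ρ hG r u).card + 1 = G.degree u := by
  rw [outerValues, Multiset.card_map, Finset.card_val,
    Finset.card_erase_add_one (by simpa using h.symm), SimpleGraph.card_neighborFinset_eq_degree]

theorem mem_outerValues {ρ : FinRootedTree.{u} → ℝ} {hG : G.IsTree} {r u : V} {a : ℝ} :
    a ∈ outerValues ρ hG r u ↔ ∃ x, G.Adj u x ∧ x ≠ r ∧ branchValue ρ hG u x = a := by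
  simp only [outerValues, Multiset.mem_map, Finset.mem_val, Finset.mem_erase,
    SimpleGraph.mem_neighborFinset]
  exact exists_congr fun x => by tauto

theorem mem_range_of_mem_outerValues {ρ : FinRootedTree.{u} → ℝ} {hG : G.IsTree} {r u : V}
    {a : ℝ} (ha : a ∈ outerValues ρ hG r u) : a ∈ Set.range ρ := by
  obtain ⟨x, hx, -, rfl⟩ := mem_outerValues.1 ha
  exact branchValue_mem_range ρ hG hx

theorem card_branch_eq_one (ρ : FinRootedTree.{u} → ℝ) (hG : G.IsTree) {r u : V}
    (h : G.Adj r u) (h0 : outerValues ρ hG r u = 0) : Nat.card (branch hG h).V = 1 := by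
  rw [Nat.card_eq_one_iff_unique]
  refine ⟨⟨?_⟩, ⟨(branch hG h).root⟩⟩
  have key : ∀ z : (branch hG h).V, z = (branch hG h).root := by
    rintro ⟨z, p, hp⟩
    refine Subtype.ext ?_
    change z = u
    cases p with
    | nil => rfl
    | @cons _ y _ huy q =>
      have hyr : y ≠ r := by
        rintro rfl
        simp at hp
      have := mem_outerValues (ρ := ρ) (hG := hG).2 ⟨y, huy, hyr, rfl⟩
      simp [h0] at this
  exact fun a b => (key a).trans (key b).symm

theorem one_lt_card_branch (ρ : FinRootedTree.{u} → ℝ) (hG : G.IsTree) {r u : V}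
    (h : G.Adj r u) (h0 : outerValues ρ hG r u ≠ 0) : 1 < Nat.card (branch hG h).V := by
  obtain ⟨a, ha⟩ := Multiset.exists_mem_of_ne_zero h0
  obtain ⟨x, hux, hxr, -⟩ := mem_outerValues.1 ha
  rw [Finite.one_lt_card_iff_nontrivial]
  exact ⟨⟨u, mem_branchSet_self h⟩,
    ⟨x, mem_branchSet_of_adj (mem_branchSet_self h) hux hxr⟩,
    fun hh => hux.ne (congrArg Subtype.val hh)⟩

theorem branchValue_eq {ρ : FinRootedTree.{u} → ℝ} (hρ : IsRootedTreeInvariant ρ)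
    {f : Multiset ℝ → ℝ} (hrec : HasRecurrenceRule ρ f) (hG : G.IsTree) {r u : V}
    (h : G.Adj r u) (h0 : outerValues ρ hG r u ≠ 0) :
    branchValue ρ hG r u = f (outerValues ρ hG r u) := by
  rw [branchValue_of_adj ρ hG h, hrec _ (one_lt_card_branch ρ hG h h0),
    branchValues_branch hρ hG h]

end BranchValue

/-! ### Monotonicity of the rule on multisets -/

section Rule

variable {ρ : FinRootedTree.{u} → ℝ} {f : Multiset ℝ → ℝ}

namespace IsStrictlyIncreasingRule

/-- Elements are replaced one at a time; `s` absorbs those already replaced. -/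
theorem add_le_add (hf : IsStrictlyIncreasingRule ρ f) (M : Multiset ℝ) :
    ∀ N s : Multiset ℝ, M.card = N.card → (∀ a ∈ M, a ∈ Set.range ρ) →
      (∀ a ∈ N, a ∈ Set.range ρ) → (∀ a ∈ s, a ∈ Set.range ρ) →
      (∀ a ∈ M, ∀ b ∈ N, a ≤ b) → f (M + s) ≤ f (N + s) := by
  induction M using Multiset.induction with
  | empty =>
    intro N s hc _ _ _ _
    rw [Multiset.card_eq_zero.1 hc.symm]
  | cons a M ih =>
    intro N s hc hM hN hs hle
    obtain ⟨b, hb⟩ := Multiset.card_pos_iff_exists_mem.1 (by rw [← hc]; simp : 0 < N.card)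
    obtain ⟨N, rfl⟩ := Multiset.exists_cons_of_mem hb
    simp only [Multiset.card_cons, Multiset.mem_cons, forall_eq_or_imp] at *
    have h1 : f (a ::ₘ (M + s)) ≤ f (b ::ₘ (M + s)) := by
      rcases hle.1.1.eq_or_lt with h | h
      · rw [h]
      · refine (hf.lt_of_lt _ ?_ a hM.1 b hN.1 h).le
        intro x hx
        rcases Multiset.mem_add.1 hx with hx | hx
        · exact hM.2 x hx
        · exact hs x hx
    have h2 := ih N (b ::ₘ s) (by omega) hM.2 hN.2
      (by simpa using ⟨by simpa using hN.1, by simpa using hs⟩) fun x hx => (hle.2 x hx).2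
    simp only [Multiset.add_cons, Multiset.cons_add] at *
    exact h1.trans h2

theorem add_lt_add (hf : IsStrictlyIncreasingRule ρ f) {M N : Multiset ℝ}
    (hc : M.card = N.card) (hM : ∀ a ∈ M, a ∈ Set.range ρ) (hN : ∀ a ∈ N, a ∈ Set.range ρ)
    (hle : ∀ a ∈ M, ∀ b ∈ N, a ≤ b) {a b : ℝ} (ha : a ∈ M) (hb : b ∈ N) (hab : a < b) :
    f M < f N := by
  obtain ⟨M, rfl⟩ := Multiset.exists_cons_of_mem ha
  obtain ⟨N, rfl⟩ := Multiset.exists_cons_of_mem hb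
  simp only [Multiset.card_cons, Multiset.mem_cons, forall_eq_or_imp] at *
  have h1 := hf.lt_of_lt M hM.2 a hM.1 b hN.1 hab
  have h2 := hf.add_le_add M N {b} (by omega) hM.2 hN.2 (by simpa using hN.1)
    fun x hx => (hle.2 x hx).2
  rw [add_comm, add_comm N, Multiset.singleton_add, Multiset.singleton_add] at h2
  exact h1.trans_le h2

theorem le_add (hf : IsStrictlyIncreasingRule ρ f) {M : Multiset ℝ} (h0 : M ≠ 0)
    (hM : ∀ a ∈ M, a ∈ Set.range ρ) (N : Multiset ℝ) :
    (∀ a ∈ N, a ∈ Set.range ρ) → f M ≤ f (N + M) := by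
  induction N using Multiset.induction with
  | empty => simp
  | cons a N ih =>
    intro hN
    simp only [Multiset.mem_cons, forall_eq_or_imp] at hN
    refine (ih hN.2).trans ?_
    rw [Multiset.cons_add]
    refine (hf.lt_cons _ (by simp [h0]) ?_ a hN.1).le
    intro x hx
    rcases Multiset.mem_add.1 hx with hx | hx
    · exact hN.2 x hx
    · exact hM x hx

theorem lt_add (hf : IsStrictlyIncreasingRule ρ f) {M N : Multiset ℝ} (h0 : M ≠ 0)
    (hM : ∀ a ∈ M, a ∈ Set.range ρ) (hN : ∀ a ∈ N, a ∈ Set.range ρ) (hN0 : N ≠ 0) :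
    f M < f (N + M) := by
  obtain ⟨a, ha⟩ := Multiset.exists_mem_of_ne_zero hN0
  obtain ⟨N, rfl⟩ := Multiset.exists_cons_of_mem ha
  simp only [Multiset.mem_cons, forall_eq_or_imp] at hN
  refine (hf.le_add h0 hM N hN.2).trans_lt ?_
  rw [Multiset.cons_add]
  refine hf.lt_cons _ (by simp [h0]) ?_ a hN.1
  intro x hx
  rcases Multiset.mem_add.1 hx with hx | hx
  · exact hN.2 x hx
  · exact hM x hx

/-- If `M` is dominated by `N` but `f N ≤ f M`, then the domination also holds in the other
direction. -/
theorem card_le_and_le_of_le (hf : IsStrictlyIncreasingRule ρ f) {M N : Multiset ℝ} (h0 : M ≠ 0)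
    (hM : ∀ a ∈ M, a ∈ Set.range ρ) (hN : ∀ a ∈ N, a ∈ Set.range ρ) (hc : M.card ≤ N.card)
    (hle : ∀ a ∈ M, ∀ b ∈ N, a ≤ b) (hfle : f N ≤ f M) :
    N.card ≤ M.card ∧ ∀ a ∈ M, ∀ b ∈ N, b ≤ a := by
  have hcard : N.card ≤ M.card := by
    by_contra! hlt
    -- With `K` a part of `N` of the size of `M` and a nonempty rest, `f M ≤ f K < f N`, a
    -- contradiction.
    obtain ⟨K, hKN, hK⟩ : ∃ K ≤ N, K.card = M.card := by
      induction N using Quotient.inductionOn with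
      | h l =>
        exact ⟨(l.take M.card : List ℝ), (List.take_sublist _ l).subperm,
          by simpa using hc⟩
    obtain ⟨L, rfl⟩ := Multiset.le_iff_exists_add.1 hKN
    simp only [Multiset.card_add, Multiset.mem_add] at *
    have h1 := hf.add_le_add M K 0 hK.symm hM (fun a ha => hN a (Or.inl ha)) (by simp)
      fun a ha b hb => hle a ha b (Or.inl hb)
    have h2 := hf.lt_add (M := K) (N := L)
      (by rw [← Multiset.card_pos, hK, Multiset.card_pos]; exact h0)
      (fun a ha => hN a (Or.inl ha)) (fun a ha => hN a (Or.inr ha))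
      (by rw [← Multiset.card_pos]; omega)
    rw [add_comm L] at h2
    simp only [add_zero] at h1
    linarith
  refine ⟨hcard, fun a ha b hb => ?_⟩
  by_contra! hab
  exact absurd hfle (not_le.2 (hf.add_lt_add (le_antisymm hc hcard) hM hN hle ha hb hab))

end IsStrictlyIncreasingRule

end Rule

/-! ### Exchange ordering and the orientation of edges -/

section ExchangeOrdered

variable {V : Type u} [Fintype V] {G : SimpleGraph V} [DecidableRel G.Adj]

/-- The values `b r u` attached to the branches of `G` are compatible with exchanges: if the branch
at `v'` through `v` has at least the value of the branch at `w'` through `w`, where `v` and `w` face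
each other, then `v` has at least the degree of `w`, and the outer branches at `v` have at least the
values of those at `w`. -/
def ExchangeOrdered (G : SimpleGraph V) [DecidableRel G.Adj] (b : V → V → ℝ) : Prop :=
  ∀ ⦃v v' w w' : V⦄, Facing G v v' w w' → b w' w ≤ b v' v →
    G.degree w ≤ G.degree v ∧
      ∀ x y, G.Adj v x → x ≠ v' → G.Adj w y → y ≠ w' → b w y ≤ b v x

/-- If extremality favours `w`, the outer values at `v` are dominated by those at `w`, while the
branch through `v` has at least the value of the branch through `w`; strict monotonicity then
reverses the domination. -/
theorem IsExchangeExtremal.exchangeOrdered {ρ : FinRootedTree.{u} → ℝ}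
    (hρ : IsRootedTreeInvariant ρ) {f : Multiset ℝ → ℝ} (hrec : HasRecurrenceRule ρ f)
    (hf : IsStrictlyIncreasingRule ρ f)
    (hmin : ∀ A B : FinRootedTree.{u}, Nat.card A.V = 1 → 1 < Nat.card B.V → ρ A < ρ B)
    {hG : G.IsTree} (hext : IsExchangeExtremal ρ hG) :
    ExchangeOrdered G (branchValue ρ hG) := by
  classical
  intro v v' w w' hF hle
  have hv := hF.ncard_outerNeighbors hG.isAcyclic
  have hw := hF.symm.ncard_outerNeighbors hG.isAcyclic
  have hmv := hF.mem_outerNeighbors_iff hG.isAcyclic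
  have hmw := hF.symm.mem_outerNeighbors_iff hG.isAcyclic
  rw [middleSet_comm] at hw hmw
  rcases hext _ v w (hF.isExchangeDecomposition hG) with ⟨hc, hb⟩ | ⟨hc, hb⟩
  · refine ⟨by omega, fun x y hx hxv hy hyw => ?_⟩
    rw [branchValue_of_adj ρ hG hx, branchValue_of_adj ρ hG hy]
    exact hb x ((hmv x).2 ⟨hx, hxv⟩) y ((hmw y).2 ⟨hy, hyw⟩)
  · have hcv := card_outerValues ρ hG hF.adj_left.symm
    have hcw := card_outerValues ρ hG hF.adj_right.symm
    have hdom : ∀ a ∈ outerValues ρ hG v' v, ∀ c ∈ outerValues ρ hG w' w, a ≤ c := by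
      intro a ha c hc
      obtain ⟨x, hx, hxv, rfl⟩ := mem_outerValues.1 ha
      obtain ⟨y, hy, hyw, rfl⟩ := mem_outerValues.1 hc
      rw [branchValue_of_adj ρ hG hx, branchValue_of_adj ρ hG hy]
      exact hb x ((hmv x).2 ⟨hx, hxv⟩) y ((hmw y).2 ⟨hy, hyw⟩)
    have key : (outerValues ρ hG w' w).card ≤ (outerValues ρ hG v' v).card ∧
        ∀ a ∈ outerValues ρ hG v' v, ∀ c ∈ outerValues ρ hG w' w, c ≤ a := by
      -- The recurrence does not cover one-vertex branches; `hmin` takes its place.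
      by_cases h0 : outerValues ρ hG v' v = 0
      · by_cases hw0 : outerValues ρ hG w' w = 0
        · simp [h0, hw0]
        · have := hmin _ _ (card_branch_eq_one ρ hG hF.adj_left.symm h0)
            (one_lt_card_branch ρ hG hF.adj_right.symm hw0)
          rw [branchValue_of_adj ρ hG hF.adj_left.symm,
            branchValue_of_adj ρ hG hF.adj_right.symm] at hle
          exact absurd hle (not_le.2 this)
      · have hw0 : outerValues ρ hG w' w ≠ 0 := by
          have := Multiset.card_pos.2 h0
          rw [← Multiset.card_pos]
          omega
        rw [branchValue_eq hρ hrec hG hF.adj_left.symm h0,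
          branchValue_eq hρ hrec hG hF.adj_right.symm hw0] at hle
        exact hf.card_le_and_le_of_le h0 (fun a => mem_range_of_mem_outerValues)
          (fun a => mem_range_of_mem_outerValues) (by omega) hdom hle
    refine ⟨by omega, fun x y hx hxv hy hyw => ?_⟩
    exact key.2 _ (mem_outerValues.2 ⟨x, hx, hxv, rfl⟩) _ (mem_outerValues.2 ⟨y, hy, hyw, rfl⟩)

theorem exists_adj_ne_of_two_le_degree {v : V} (h : 2 ≤ G.degree v) (w : V) :
    ∃ x, G.Adj v x ∧ x ≠ w := by
  classical
  obtain ⟨x, hx, hxw⟩ := Finset.exists_mem_ne (s := G.neighborFinset v)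
    (by rw [SimpleGraph.card_neighborFinset_eq_degree]; omega) w
  exact ⟨x, by simpa using hx, hxw⟩

namespace ExchangeOrdered

variable {b : V → V → ℝ}

/-- Two paths that dominate each other with a shift by one vertex could be extended forever. -/
theorem false_of_shifted_paths (hb : ExchangeOrdered G b) (hG : G.IsTree) (n : ℕ) :
    ∀ l l' x m m' y : V, (branchSet G l' l).ncard ≤ n → Facing G l l' m' x → b x m' ≤ b l' l →
      Facing G m m' l' y → b y l' ≤ b m' m → x ≠ m → y ≠ l → 2 ≤ G.degree l → 2 ≤ G.degree m →
      False := by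
  induction n with
  | zero =>
    intro l l' x m m' y hn hl _ _ _ _ _ _ _
    have : l ∈ branchSet G l' l := mem_branchSet_self hl.adj_left.symm
    rw [Nat.le_zero, Set.ncard_eq_zero] at hn
    simp [hn] at this
  | succ n ih =>
    intro l l' x m m' y hn hl hlb hm hmb hxm hyl hdl hdm
    obtain ⟨p, hlp, hpl⟩ := exists_adj_ne_of_two_le_degree hdl l'
    obtain ⟨q, hmq, hqm⟩ := exists_adj_ne_of_two_le_degree hdm m'
    have hFl := hl.outer hG.isAcyclic hlp hpl hm.adj_left.symm hxm.symm
    have hFm := hm.outer hG.isAcyclic hmq hqm hl.adj_left.symm hyl.symm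
    have hbl := (hb hl hlb).2 p m hlp hpl hm.adj_left.symm hxm.symm
    have hbm := (hb hm hmb).2 q l hmq hqm hl.adj_left.symm hyl.symm
    -- The path `l, l', …, m', m` grows to `p, l, …, m, q`. Each new end dominates the old end on
    -- the other side, so it has degree at least 2 and the path can grow again, while the branch
    -- beyond `l` shrinks.
    refine ih p l m' q m l' ?_ hFl hbl hFm hbm hqm.symm hpl.symm
      (hdm.trans (hb hFl hbl).1) (hdl.trans (hb hFm hbm).1)
    have := Set.ncard_lt_ncard (branchSet_ssubset hG.isAcyclic hl.adj_left.symm hlp hpl)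
    omega

theorem two_le_degree_of_adj {c a e : V} (ha : G.Adj c a) (he : G.Adj c e) (hae : a ≠ e) :
    2 ≤ G.degree c := by
  classical
  rw [← SimpleGraph.card_neighborFinset_eq_degree]
  exact Finset.one_lt_card.2 ⟨a, by simpa using ha, e, by simpa using he, hae⟩

/-- At most one of the edges at `c` can point away from `c`. -/
theorem lt_of_le (hb : ExchangeOrdered G b) (hG : G.IsTree) {c a e : V} (ha : G.Adj c a)
    (he : G.Adj c e) (hae : a ≠ e) (h : b a c ≤ b c a) : b c e < b e c := by
  by_contra! h'
  have hdc := two_le_degree_of_adj ha he hae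
  have hFa : Facing G a c c a := Facing.of_adj ha.symm
  have hFe : Facing G e c c e := Facing.of_adj he.symm
  -- The starting path is `a, c, e`, with `c` as the inner vertex for both ends.
  exact hb.false_of_shifted_paths hG _ a c a e c e le_rfl hFa h hFe h' hae hae.symm
    (hdc.trans (hb hFa h).1) (hdc.trans (hb hFe h').1)

end ExchangeOrdered

/-- Orienting the edges of a finite tree by comparing two weights yields a sink. -/
theorem exists_sink (hG : G.IsTree) (b : V → V → ℝ) : ∃ r, ∀ u, G.Adj r u → b r u ≤ b u r := by
  classical
  by_contra! h
  choose g hg hlt using h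
  -- An edge chosen by both of its ends would have each of its two weights strictly larger than the
  -- other.
  have hinj : Function.Injective fun c => (⟨s(c, g c), hg c⟩ : G.edgeSet) := by
    intro c d hcd
    have := congrArg Subtype.val hcd
    simp only [Sym2.eq_iff] at this
    rcases this with ⟨h, -⟩ | ⟨h1, h2⟩
    · exact h
    · have h3 := hlt c
      have h4 := hlt d
      rw [h2] at h3
      rw [← h1] at h4
      exact absurd h3 (not_lt.2 h4.le)
  have h1 : Nat.card V ≤ Nat.card G.edgeSet := Nat.card_le_card_of_injective _ hinj
  have h2 := hG.card_edgeFinset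
  rw [SimpleGraph.edgeFinset_card, ← Nat.card_eq_fintype_card, ← Nat.card_eq_fintype_card] at h2
  omega

end ExchangeOrdered

/-! ### The tree rooted at a sink, and comparison of levels -/

section Rooted

variable {V : Type u} {G : SimpleGraph V}

/-- In the tree `G` rooted at `r`, the depth of a vertex is given by `d`, and the parent of a vertex
other than `r` by `p`. -/
structure IsParentMap (G : SimpleGraph V) (r : V) (d : V → ℕ) (p : V → V) : Prop where
  depth_eq_zero_iff : ∀ v, d v = 0 ↔ v = r
  adj : ∀ v, v ≠ r → G.Adj (p v) v
  depth_eq : ∀ v, v ≠ r → d v = d (p v) + 1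
  parent_eq_of_adj : ∀ v w, G.Adj v w → (w ≠ r ∧ p w = v) ∨ (v ≠ r ∧ p v = w)

/-- A shortest walk from `r` to `a` is too short to pass through `v`. -/
theorem SimpleGraph.IsTree.mem_branchSet_of_dist_lt (hG : G.IsTree) {r v a : V}
    (h : G.dist r a < G.dist r v) : r ∈ branchSet G v a := by
  classical
  obtain ⟨q, hq⟩ := hG.1.exists_walk_length_eq_dist r a
  refine mem_branchSet_symm ⟨q, fun hv => ?_⟩
  have h1 := SimpleGraph.dist_le (q.takeUntil v hv)
  have h2 := q.length_takeUntil_le_length hv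
  omega

theorem SimpleGraph.IsTree.exists_isParentMap (hG : G.IsTree) (r : V) :
    ∃ p, IsParentMap G r (G.dist r) p := by
  classical
  have hex : ∀ v, ∃ u, v ≠ r → G.Adj u v ∧ G.dist r v = G.dist r u + 1 := by
    intro v
    by_cases hv : v = r
    · exact ⟨v, fun h => absurd hv h⟩
    · obtain ⟨q, hq⟩ := hG.1.exists_walk_length_eq_dist v r
      cases q with
      | nil => exact absurd rfl hv
      | @cons _ y _ hvy q =>
        refine ⟨y, fun _ => ⟨hvy.symm, ?_⟩⟩
        have h1 := SimpleGraph.dist_le q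
        have h2 := hG.dist_eq_dist_add_one_of_adj r hvy
        rw [SimpleGraph.Walk.length_cons, SimpleGraph.dist_comm] at hq
        rw [SimpleGraph.dist_comm] at h1
        omega
  choose p hp using hex
  have huniq : ∀ v w, G.Adj v w → G.dist r w = G.dist r v + 1 → w ≠ r ∧ p w = v := by
    intro v w hvw h
    have hw : w ≠ r := by
      rintro rfl
      simp at h
    obtain ⟨h1, h2⟩ := hp w hw
    -- Both `p w` and `v` are nearer to `r` than `w`, so they lie in the branch at `w` that contains
    -- `r`.
    refine ⟨hw, eq_of_mem_branchSet hG.isAcyclic h1.symm hvw.symm ?_⟩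
    exact mem_branchSet_trans (hG.mem_branchSet_of_dist_lt (r := r) (by omega))
      (mem_branchSet_symm (hG.mem_branchSet_of_dist_lt (by omega)))
  refine ⟨p, fun v => ?_, fun v hv => (hp v hv).1, fun v hv => (hp v hv).2, fun v w hvw => ?_⟩
  · rw [hG.1.dist_eq_zero_iff, eq_comm]
  · rcases hG.dist_eq_dist_add_one_of_adj r hvw with h | h
    · exact Or.inr (huniq w v hvw.symm h)
    · exact Or.inl (huniq v w hvw h)

namespace IsParentMap

variable {r : V} {d : V → ℕ} {p : V → V}

theorem ne_root_of_depth (hp : IsParentMap G r d p) {v : V} {k : ℕ} (h : d v = k + 1) : v ≠ r :=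
  fun hv => by
    rw [(hp.depth_eq_zero_iff v).2 hv] at h
    omega

theorem depth_parent (hp : IsParentMap G r d p) {v : V} {k : ℕ} (h : d v = k + 1) :
    d (p v) = k := by
  have := hp.depth_eq v (hp.ne_root_of_depth h)
  omega

theorem ne_parent_parent (hp : IsParentMap G r d p) {v : V} (hv : v ≠ r) (hpv : p v ≠ r) :
    v ≠ p (p v) := fun h => by
  have h1 := hp.depth_eq v hv
  have h2 := hp.depth_eq _ hpv
  rw [← h] at h2
  omega

theorem facing_of_depth_eq (hG : G.IsAcyclic) (hp : IsParentMap G r d p) (k : ℕ) :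
    ∀ v w, d v = k → d w = k → v ≠ w → Facing G v (p v) w (p w) := by
  induction k with
  | zero =>
    intro v w hv hw hvw
    exact absurd (((hp.depth_eq_zero_iff v).1 hv).trans ((hp.depth_eq_zero_iff w).1 hw).symm) hvw
  | succ k ih =>
    intro v w hv hw hvw
    have hvr := hp.ne_root_of_depth hv
    have hwr := hp.ne_root_of_depth hw
    have hpv := hp.depth_parent hv
    have hpw := hp.depth_parent hw
    by_cases hpp : p v = p w
    · have hav := hp.adj v hvr
      rw [hpp] at hav ⊢
      exact Facing.of_common_neighbor hav (hp.adj w hwr) hvw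
    · have hr : ∀ z, d z = k → z ≠ r := by
        rintro z hz rfl
        rw [(hp.depth_eq_zero_iff z).2 rfl] at hz
        exact hpp (((hp.depth_eq_zero_iff _).1 (hpv.trans hz.symm)).trans
          ((hp.depth_eq_zero_iff _).1 (hpw.trans hz.symm)).symm)
      exact (ih _ _ hpv hpw hpp).outer hG (hp.adj v hvr) (hp.ne_parent_parent hvr (hr _ hpv))
        (hp.adj w hwr) (hp.ne_parent_parent hwr (hr _ hpw))

variable [Fintype V] [DecidableRel G.Adj] {b : V → V → ℝ}

theorem branch_le_of_sink (hG : G.IsTree) (hp : IsParentMap G r d p) (hb : ExchangeOrdered G b)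
    (hr : ∀ u, G.Adj r u → b r u ≤ b u r) (k : ℕ) :
    ∀ e, d e = k + 1 → b (p e) e ≤ b e (p e) := by
  induction k with
  | zero =>
    intro e he
    have hpe := (hp.depth_eq_zero_iff _).1 (hp.depth_parent he)
    have hadj := hp.adj e (hp.ne_root_of_depth he)
    rw [hpe] at hadj ⊢
    exact hr e hadj
  | succ k ih =>
    intro e he
    have her := hp.ne_root_of_depth he
    have hpe := hp.depth_parent he
    have hcr := hp.ne_root_of_depth hpe
    exact (hb.lt_of_le hG (hp.adj _ hcr).symm (hp.adj e her)
      (hp.ne_parent_parent her hcr).symm (ih _ hpe)).le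

/-- Passing to parents on both sides ends at an edge from `p v` down to `p w`. That edge points
upwards, and exchange ordering carries the inequality back down. The excluded case `p w = v` is a
single edge, where `v` does not face `w` through its parent. -/
theorem facing_of_depth_succ (hG : G.IsTree) (hp : IsParentMap G r d p)
    (hb : ExchangeOrdered G b) (hup : ∀ e, e ≠ r → b (p e) e ≤ b e (p e)) (k : ℕ) :
    ∀ v w, d v = k → d w = k + 1 → p w ≠ v →
    Facing G v (p v) w (p w) ∧ b (p w) w ≤ b (p v) v := by
  induction k with
  | zero =>
    intro v w hv hw hne
    exact absurd (((hp.depth_eq_zero_iff _).1 (hp.depth_parent hw)).trans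
      ((hp.depth_eq_zero_iff v).1 hv).symm) hne
  | succ k ih =>
    intro v w hv hw hne
    have hvr := hp.ne_root_of_depth hv
    have hwr := hp.ne_root_of_depth hw
    have hpv := hp.depth_parent hv
    have hpw := hp.depth_parent hw
    have hpwr := hp.ne_root_of_depth hpw
    by_cases hpp : p (p w) = p v
    · have hF : Facing G (p v) (p w) (p w) (p v) := Facing.of_adj (hpp ▸ hp.adj _ hpwr)
      have hle : b (p v) (p w) ≤ b (p w) (p v) := hpp ▸ hup _ hpwr
      have hw' : w ≠ p v := hpp ▸ hp.ne_parent_parent hwr hpwr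
      exact ⟨hF.outer hG.isAcyclic (hp.adj v hvr) hne.symm (hp.adj w hwr) hw',
        (hb hF hle).2 v w (hp.adj v hvr) hne.symm (hp.adj w hwr) hw'⟩
    · obtain ⟨hF, hle⟩ := ih _ _ hpv hpw hpp
      have hpvr : p v ≠ r := by
        intro h
        rw [(hp.depth_eq_zero_iff _).2 h] at hpv
        subst hpv
        exact hpp (((hp.depth_eq_zero_iff _).1 (hp.depth_parent hpw)).trans h.symm)
      have hv' := hp.ne_parent_parent hvr hpvr
      have hw' := hp.ne_parent_parent hwr hpwr
      exact ⟨hF.outer hG.isAcyclic (hp.adj v hvr) hv' (hp.adj w hwr) hw',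
        (hb hF hle).2 v w (hp.adj v hvr) hv' (hp.adj w hwr) hw'⟩

theorem degree_le_of_depth_succ (hG : G.IsTree) (hp : IsParentMap G r d p)
    (hb : ExchangeOrdered G b) (hup : ∀ e, e ≠ r → b (p e) e ≤ b e (p e)) {v w : V}
    (h : d w = d v + 1) : G.degree w ≤ G.degree v := by
  by_cases hpw : p w = v
  · have hwr := hp.ne_root_of_depth h
    subst hpw
    exact (hb (Facing.of_adj (hp.adj w hwr)) (hup w hwr)).1
  · obtain ⟨hF, hle⟩ := facing_of_depth_succ hG hp hb hup (d v) v w rfl h hpw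
    exact (hb hF hle).1

theorem degree_le_of_depth_lt (hG : G.IsTree) (hp : IsParentMap G r d p)
    (hb : ExchangeOrdered G b) (hup : ∀ e, e ≠ r → b (p e) e ≤ b e (p e)) (v : V)
    (k : ℕ) :
    ∀ w, d w = d v + 1 + k → G.degree w ≤ G.degree v := by
  induction k with
  | zero => exact fun w hw => degree_le_of_depth_succ hG hp hb hup hw
  | succ k ih =>
    intro w hw
    have hpw := hp.depth_parent (k := d v + 1 + k) (by omega)
    exact (degree_le_of_depth_succ hG hp hb hup (by omega)).trans (ih _ hpw)

end IsParentMap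

end Rooted

/-! ### Ranks with respect to a key -/

section Rank

variable {V α : Type*} [Fintype V] [LinearOrder α]

/-- The number of elements whose key is smaller than that of `v`. -/
def keyRank (key : V → α) (v : V) : ℕ :=
  (Finset.univ.filter fun u => key u < key v).card

theorem keyRank_lt_keyRank_of_lt {key : V → α} {v w : V} (h : key v < key w) :
    keyRank key v < keyRank key w := by
  refine Finset.card_lt_card ⟨fun u hu => ?_, fun hs => ?_⟩
  · simp only [Finset.mem_filter, Finset.mem_univ, true_and] at *
    exact hu.trans h
  · have : v ∈ Finset.univ.filter fun u => key u < key v := hs (by simpa using h)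
    simp at this

theorem keyRank_lt_iff {key : V → α} {v w : V} :
    keyRank key v < keyRank key w ↔ key v < key w := by
  refine ⟨fun h => ?_, keyRank_lt_keyRank_of_lt⟩
  by_contra! hle
  rcases hle.lt_or_eq with hlt | heq
  · exact absurd h (not_lt.2 (keyRank_lt_keyRank_of_lt hlt).le)
  · simp [keyRank, heq] at h

theorem keyRank_eq_iff {key : V → α} {v w : V} :
    keyRank key v = keyRank key w ↔ key v = key w := by
  rw [eq_iff_le_not_lt, eq_iff_le_not_lt (a := key v), ← not_lt, ← not_lt, keyRank_lt_iff,
    keyRank_lt_iff]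

theorem keyRank_lt_card (key : V → α) (v : V) : keyRank key v < Fintype.card V :=
  Finset.card_lt_univ_of_notMem (x := v) (by simp)

end Rank

/-! ### The breadth-first order and its degrees -/

section BreadthFirst

variable {V : Type u} [Fintype V] {G : SimpleGraph V}

open Classical in
/-- The rank of a vertex within level `k`: vertices are ordered by the ranks of their parents first,
by decreasing branch values next, and arbitrarily in case of ties. -/
noncomputable def levelRank (p : V → V) (b : V → V → ℝ) : ℕ → V → ℕ
  | 0 => fun _ => 0
  | k + 1 => keyRank fun v =>
      toLex (levelRank p b k (p v), toLex (OrderDual.toDual (b (p v) v), Fintype.equivFin V v))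

theorem levelRank_succ_lt_iff {p : V → V} {b : V → V → ℝ} {k : ℕ} {v w : V} :
    levelRank p b (k + 1) v < levelRank p b (k + 1) w ↔
      levelRank p b k (p v) < levelRank p b k (p w) ∨
        levelRank p b k (p v) = levelRank p b k (p w) ∧ (b (p w) w < b (p v) v ∨
          b (p v) v = b (p w) w ∧ Fintype.equivFin V v < Fintype.equivFin V w) := by
  simp [levelRank, keyRank_lt_iff, Prod.Lex.toLex_lt_toLex]

/-- The enumeration of `V` breaks all ties. The rank is taken over all of `V`, but only its
comparisons between vertices of depth `k + 1` matter. -/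
theorem levelRank_succ_injective {p : V → V} {b : V → V → ℝ} {k : ℕ} :
    Function.Injective (levelRank p b (k + 1)) := by
  intro v w h
  simp only [levelRank, keyRank_eq_iff, EmbeddingLike.apply_eq_iff_eq, Prod.mk.injEq] at h
  exact h.2.2

/-- The key by which the vertices are sorted in breadth-first order. -/
noncomputable def breadthFirstKey (d : V → ℕ) (p : V → V) (b : V → V → ℝ) (v : V) : ℕ ×ₗ ℕ :=
  toLex (d v, levelRank p b (d v) v)

theorem breadthFirstKey_lt_iff {d : V → ℕ} {p : V → V} {b : V → V → ℝ} {v w : V} :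
    breadthFirstKey d p b v < breadthFirstKey d p b w ↔
      d v < d w ∨ d v = d w ∧ levelRank p b (d v) v < levelRank p b (d w) w := by
  simp [breadthFirstKey, Prod.Lex.toLex_lt_toLex]

namespace IsParentMap

variable {r : V} {d : V → ℕ} {p : V → V} {b : V → V → ℝ}

theorem breadthFirstKey_injective (hp : IsParentMap G r d p) :
    Function.Injective (breadthFirstKey d p b) := by
  intro v w h
  simp only [breadthFirstKey, EmbeddingLike.apply_eq_iff_eq, Prod.mk.injEq] at h
  obtain ⟨h1, h2⟩ := h
  rw [h1] at h2
  rcases hk : d w with _ | k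
  · rw [hk] at h1
    rw [(hp.depth_eq_zero_iff v).1 h1, (hp.depth_eq_zero_iff w).1 hk]
  · rw [hk] at h2
    exact levelRank_succ_injective h2

theorem breadthFirstKey_root_lt (hp : IsParentMap G r d p) {v : V} (hv : v ≠ r) :
    breadthFirstKey d p b r < breadthFirstKey d p b v := by
  rw [breadthFirstKey_lt_iff, hp.depth_eq v hv, (hp.depth_eq_zero_iff r).2 rfl]
  exact Or.inl (Nat.succ_pos _)

theorem breadthFirstKey_parent_le (hp : IsParentMap G r d p) {v w : V} (hv : v ≠ r) (hw : w ≠ r)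
    (h : breadthFirstKey d p b v < breadthFirstKey d p b w) :
    breadthFirstKey d p b (p v) ≤ breadthFirstKey d p b (p w) := by
  rw [← not_lt]
  rw [breadthFirstKey_lt_iff] at *
  rw [hp.depth_eq v hv, hp.depth_eq w hw] at h
  rintro (h' | ⟨h1, h2⟩)
  · omega
  · rw [h1, levelRank_succ_lt_iff] at h
    rw [h1] at h2
    omega

variable [DecidableRel G.Adj]

/-- For siblings the order is by branch value. For distinct parents, the earlier parent has the
larger branch by induction, and exchange ordering passes this on to all pairs of children. -/
theorem branch_le_of_levelRank_lt (hG : G.IsTree) (hp : IsParentMap G r d p)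
    (hb : ExchangeOrdered G b) (k : ℕ) : ∀ v w, d v = k → d w = k →
      levelRank p b k v < levelRank p b k w → b (p w) w ≤ b (p v) v := by
  induction k with
  | zero =>
    intro v w _ _ h
    simp [levelRank] at h
  | succ k ih =>
    intro v w hv hw h
    have hvr := hp.ne_root_of_depth hv
    have hwr := hp.ne_root_of_depth hw
    have hpv := hp.depth_parent hv
    have hpw := hp.depth_parent hw
    rcases levelRank_succ_lt_iff.1 h with h | ⟨-, h | h⟩
    · have hne : p v ≠ p w := fun hpp => by simp [hpp] at h
      have hk : k ≠ 0 := by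
        rintro rfl
        simp [levelRank] at h
      have hr : ∀ z, d z = k → z ≠ r := fun z hz hzr =>
        hk (hz.symm.trans ((hp.depth_eq_zero_iff z).2 hzr))
      exact (hb (hp.facing_of_depth_eq hG.isAcyclic k _ _ hpv hpw hne)
        (ih _ _ hpv hpw h)).2 v w (hp.adj v hvr) (hp.ne_parent_parent hvr (hr _ hpv))
          (hp.adj w hwr) (hp.ne_parent_parent hwr (hr _ hpw))
    · exact h.le
    · exact h.1.ge

theorem degree_le_of_breadthFirstKey_lt (hG : G.IsTree) (hp : IsParentMap G r d p)
    (hb : ExchangeOrdered G b) (hup : ∀ e, e ≠ r → b (p e) e ≤ b e (p e)) {v w : V}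
    (h : breadthFirstKey d p b v < breadthFirstKey d p b w) : G.degree w ≤ G.degree v := by
  rcases breadthFirstKey_lt_iff.1 h with h | ⟨h1, h2⟩
  · exact hp.degree_le_of_depth_lt hG hb hup v (d w - d v - 1) w (by omega)
  · rw [h1] at h2
    have hne : v ≠ w := fun hvw => by simp [hvw] at h2
    exact (hb (hp.facing_of_depth_eq hG.isAcyclic _ v w h1 rfl hne)
      (hp.branch_le_of_levelRank_lt hG hb _ v w h1 rfl h2)).1

end IsParentMap

end BreadthFirst

/-! ### Recognising the greedy tree -/

section Greedy

theorem greedyFirstChild_succ (D : List ℕ) (i : ℕ) :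
    greedyFirstChild D (i + 1) = greedyFirstChild D i + greedyChildCount D i := by
  rw [greedyFirstChild, greedyFirstChild, Finset.sum_range_succ, add_assoc]

theorem greedyFirstChild_mono (D : List ℕ) : Monotone (greedyFirstChild D) :=
  monotone_nat_of_le_succ fun i => by
    rw [greedyFirstChild_succ]
    exact Nat.le_add_right _ _

section Rank

variable {V α : Type*} [Fintype V] [LinearOrder α]

theorem image_keyRank {key : V → α} (hkey : Function.Injective key) (u : V) :
    (Finset.univ.filter fun x => key x < key u).image (keyRank key) =
      Finset.range (keyRank key u) := by
  have hinj : Function.Injective (keyRank key) := fun x y h => hkey (keyRank_eq_iff.1 h)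
  refine Finset.eq_of_subset_of_card_le ?_ ?_
  · intro i hi
    simp only [Finset.mem_image, Finset.mem_filter, Finset.mem_univ, true_and] at hi
    obtain ⟨x, hx, rfl⟩ := hi
    exact Finset.mem_range.2 (keyRank_lt_iff.2 hx)
  · rw [Finset.card_image_of_injective _ hinj, Finset.card_range]
    exact le_rfl

theorem sum_range_keyRank {key : V → α} (hkey : Function.Injective key) (g : ℕ → ℕ) (u : V) :
    ∑ m ∈ Finset.range (keyRank key u), g m =
      ∑ x ∈ Finset.univ.filter (fun x => key x < key u), g (keyRank key x) := by
  rw [← image_keyRank hkey, Finset.sum_image]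
  exact fun x _ y _ h => hkey (keyRank_eq_iff.1 h)

/-- The enumeration of a finite type in the order of an injective key. -/
noncomputable def keyEquiv {key : V → α} (hkey : Function.Injective key) :
    V ≃ Fin (Fintype.card V) :=
  Equiv.ofBijective (fun v => ⟨keyRank key v, keyRank_lt_card key v⟩) <| by
    rw [Fintype.bijective_iff_injective_and_card]
    refine ⟨fun x y h => hkey (keyRank_eq_iff.1 ?_), by simp⟩
    simpa using h

theorem keyEquiv_val {key : V → α} (hkey : Function.Injective key) (v : V) :
    (keyEquiv hkey v : ℕ) = keyRank key v := rfl

end Rank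

variable {V : Type u} [Fintype V] {G : SimpleGraph V} [DecidableRel G.Adj]

theorem length_degreeSequence (G : SimpleGraph V) [DecidableRel G.Adj] :
    (degreeSequence G).length = Fintype.card V := by
  simp [degreeSequence]

theorem degreeSequence_eq_ofFn {n : ℕ} (e : V ≃ Fin n)
    (he : ∀ v w, e v < e w → G.degree w ≤ G.degree v) :
    degreeSequence G = List.ofFn fun i => G.degree (e.symm i) := by
  refine List.Perm.eq_of_pairwise' (r := (· ≥ ·)) ?_ ?_ ?_
  · exact Multiset.pairwise_sort _ _
  · rw [List.pairwise_ofFn]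
    intro i j hij
    exact he _ _ (by simpa using hij)
  · rw [← Multiset.coe_eq_coe, degreeSequence, Multiset.sort_eq, List.ofFn_eq_map,
      ← Multiset.map_coe]
    have : ((List.finRange n : List (Fin n)) : Multiset (Fin n)) =
        (Finset.univ : Finset (Fin n)).val := rfl
    rw [this, ← Finset.map_univ_equiv e, Finset.map_val, Multiset.map_map]
    exact Multiset.map_congr rfl fun v _ =>
      congrArg (fun x => G.degree x) (e.symm_apply_apply v).symm

theorem getD_degreeSequence_keyRank {α : Type*} [LinearOrder α] {key : V → α}
    (hkey : Function.Injective key) (hdeg : ∀ v w, key v < key w → G.degree w ≤ G.degree v)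
    (v : V) : (degreeSequence G).getD (keyRank key v) 0 = G.degree v := by
  classical
  rw [degreeSequence_eq_ofFn (keyEquiv hkey) fun v w h => hdeg v w (keyRank_lt_iff.1 h),
    List.getD_eq_getElem _ _ (by simpa using keyRank_lt_card key v), List.getElem_ofFn]
  exact congrArg (fun x => G.degree x) ((keyEquiv hkey).symm_apply_apply v)

namespace IsParentMap

variable {r : V} {d : V → ℕ} {p : V → V}

theorem card_children [DecidableEq V] (hp : IsParentMap G r d p) (u : V) :
    (Finset.univ.filter fun x => x ≠ r ∧ p x = u).card =
      if u = r then G.degree u else G.degree u - 1 := by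
  split_ifs with hu
  · rw [← SimpleGraph.card_neighborFinset_eq_degree]
    congr 1
    ext x
    simp only [Finset.mem_filter, Finset.mem_univ, true_and, SimpleGraph.mem_neighborFinset]
    constructor
    · rintro ⟨hx, rfl⟩
      exact hp.adj x hx
    · intro h
      rcases hp.parent_eq_of_adj u x h with h' | h'
      · exact h'
      · exact absurd hu h'.1
  · rw [← SimpleGraph.card_neighborFinset_eq_degree,
      ← Finset.card_erase_of_mem (a := p u) (by simpa using (hp.adj u hu).symm)]
    congr 1
    ext x
    simp only [Finset.mem_filter, Finset.mem_univ, true_and, SimpleGraph.mem_neighborFinset,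
      Finset.mem_erase]
    constructor
    · rintro ⟨hx, rfl⟩
      exact ⟨hp.ne_parent_parent hx hu, hp.adj x hx⟩
    · rintro ⟨hxu, h⟩
      rcases hp.parent_eq_of_adj u x h with h' | h'
      · exact h'
      · exact absurd h'.2.symm hxu

variable {α : Type*} [LinearOrder α] {key : V → α}

theorem keyRank_root (hroot : ∀ v, v ≠ r → key r < key v) : keyRank key r = 0 := by
  rw [keyRank, Finset.card_eq_zero, Finset.filter_eq_empty_iff]
  intro u _ hu
  by_cases hur : u = r
  · simp [hur] at hu
  · exact lt_asymm hu (hroot u hur)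

theorem greedyChildCount_keyRank [DecidableEq V] (hp : IsParentMap G r d p)
    (hkey : Function.Injective key) (hroot : ∀ v, v ≠ r → key r < key v)
    (hdeg : ∀ v w, key v < key w → G.degree w ≤ G.degree v) (u : V) :
    greedyChildCount (degreeSequence G) (keyRank key u) =
      (Finset.univ.filter fun x => x ≠ r ∧ p x = u).card := by
  rw [hp.card_children, greedyChildCount]
  by_cases hu : u = r
  · rw [if_pos hu, if_pos (by rw [hu, keyRank_root hroot]), ← getD_degreeSequence_keyRank hkey hdeg,
      hu, keyRank_root hroot]
  · rw [if_neg hu, if_neg, getD_degreeSequence_keyRank hkey hdeg]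
    have := keyRank_lt_iff.2 (hroot u hu)
    omega

/-- The child counts of the vertices before `u` add up to the number of vertices whose parent
precedes `u`; the extra 1 is the root. -/
theorem greedyFirstChild_keyRank [DecidableEq V] (hp : IsParentMap G r d p)
    (hkey : Function.Injective key) (hroot : ∀ v, v ≠ r → key r < key v)
    (hdeg : ∀ v w, key v < key w → G.degree w ≤ G.degree v) (u : V) :
    greedyFirstChild (degreeSequence G) (keyRank key u) =
      1 + (Finset.univ.filter fun x => x ≠ r ∧ key (p x) < key u).card := by
  rw [greedyFirstChild, sum_range_keyRank hkey]
  congr 1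
  rw [Finset.card_eq_sum_card_fiberwise (f := p) (t := Finset.univ.filter fun x => key x < key u)]
  · refine Finset.sum_congr rfl fun x hx => ?_
    rw [hp.greedyChildCount_keyRank hkey hroot hdeg]
    congr 1
    ext y
    simp only [Finset.mem_filter, Finset.mem_univ, true_and] at *
    constructor
    · rintro ⟨h1, rfl⟩
      exact ⟨⟨h1, hx⟩, rfl⟩
    · rintro ⟨⟨h1, -⟩, h2⟩
      exact ⟨h1, h2⟩
  · intro x hx
    simp only [Finset.coe_filter, Finset.mem_univ, true_and, Set.mem_ofPred_eq] at *
    exact hx.2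

/-- The labels of the children of a vertex are those given to them by the greedy construction. -/
theorem greedyFirstChild_le_and_lt [DecidableEq V] (hp : IsParentMap G r d p)
    (hkey : Function.Injective key) (hroot : ∀ v, v ≠ r → key r < key v)
    (hpar : ∀ v w, v ≠ r → w ≠ r → key v < key w → key (p v) ≤ key (p w))
    (hdeg : ∀ v w, key v < key w → G.degree w ≤ G.degree v) {w : V} (hw : w ≠ r) :
    greedyFirstChild (degreeSequence G) (keyRank key (p w)) ≤ keyRank key w ∧
      keyRank key w < greedyFirstChild (degreeSequence G) (keyRank key (p w) + 1) := by
  rw [greedyFirstChild_succ, hp.greedyFirstChild_keyRank hkey hroot hdeg,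
    hp.greedyChildCount_keyRank hkey hroot hdeg]
  constructor
  -- The root and the children of vertices before `p w` all precede `w`.
  · rw [add_comm, ← Finset.card_insert_of_notMem (a := r) (by simp)]
    refine Finset.card_le_card fun x hx => ?_
    simp only [Finset.mem_insert, Finset.mem_filter, Finset.mem_univ, true_and] at *
    rcases hx with rfl | ⟨hx, hlt⟩
    · exact hroot w hw
    · by_contra! hle
      rcases hle.lt_or_eq with h | h
      · exact absurd hlt (not_lt.2 (hpar w x hw hx h))
      · rw [hkey h] at hlt
        exact lt_irrefl _ hlt
  -- Conversely, everything before `w` is the root or a child of a vertex up to `p w`; the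
  -- inequality is strict because `w` itself is such a child.
  · rw [add_assoc, ← Finset.card_union_of_disjoint, add_comm,
      ← Finset.card_insert_of_notMem (a := r) (by simp)]
    · refine Finset.card_lt_card ⟨fun x hx => ?_, fun hs => ?_⟩
      · simp only [Finset.mem_insert, Finset.mem_union, Finset.mem_filter, Finset.mem_univ,
          true_and] at *
        by_cases hxr : x = r
        · exact Or.inl hxr
        · rcases (hpar x w hxr hw hx).lt_or_eq with h | h
          · exact Or.inr (Or.inl ⟨hxr, h⟩)
          · exact Or.inr (Or.inr ⟨hxr, hkey h⟩)
      · have : w ∈ Finset.univ.filter fun u => key u < key w := hs (by simp [hw])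
        simp at this
    · refine Finset.disjoint_left.2 fun x hx hx' => ?_
      simp only [Finset.mem_filter, Finset.mem_univ, true_and] at *
      rw [hx'.2] at hx
      exact lt_irrefl _ hx.2

/-- The label intervals of distinct vertices are disjoint by monotonicity of `greedyFirstChild`, so
the interval containing the label of `w` identifies its parent. -/
theorem greedyFirstChild_le_and_lt_iff [DecidableEq V] (hp : IsParentMap G r d p)
    (hkey : Function.Injective key) (hroot : ∀ v, v ≠ r → key r < key v)
    (hpar : ∀ v w, v ≠ r → w ≠ r → key v < key w → key (p v) ≤ key (p w))
    (hdeg : ∀ v w, key v < key w → G.degree w ≤ G.degree v) (u w : V) :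
    (greedyFirstChild (degreeSequence G) (keyRank key u) ≤ keyRank key w ∧
      keyRank key w < greedyFirstChild (degreeSequence G) (keyRank key u + 1)) ↔
      w ≠ r ∧ p w = u := by
  constructor
  · rintro ⟨h1, h2⟩
    have hw : w ≠ r := by
      rintro rfl
      rw [keyRank_root hroot, greedyFirstChild] at h1
      omega
    refine ⟨hw, ?_⟩
    obtain ⟨h3, h4⟩ := hp.greedyFirstChild_le_and_lt hkey hroot hpar hdeg hw
    have hmono := greedyFirstChild_mono (degreeSequence G)
    by_contra hne
    have hne' : keyRank key (p w) ≠ keyRank key u := fun h => hne (hkey (keyRank_eq_iff.1 h))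
    rcases hne'.lt_or_gt with h | h
    · have := hmono (Nat.succ_le_of_lt h)
      simp only [Nat.succ_eq_add_one] at this
      omega
    · have := hmono (Nat.succ_le_of_lt h)
      simp only [Nat.succ_eq_add_one] at this
      omega
  · rintro ⟨hw, rfl⟩
    exact hp.greedyFirstChild_le_and_lt hkey hroot hpar hdeg hw

/-- A tree is the greedy tree of its degree sequence if its vertices can be arranged in a
breadth-first order in which the degrees do not increase. -/
theorem nonempty_iso_greedyTree (hp : IsParentMap G r d p)
    (hkey : Function.Injective key) (hroot : ∀ v, v ≠ r → key r < key v)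
    (hpar : ∀ v w, v ≠ r → w ≠ r → key v < key w → key (p v) ≤ key (p w))
    (hdeg : ∀ v w, key v < key w → G.degree w ≤ G.degree v) :
    Nonempty (G ≃g greedyTree (degreeSequence G)) := by
  classical
  refine ⟨⟨(keyEquiv hkey).trans (finCongr (length_degreeSequence G).symm), ?_⟩⟩
  intro u w
  have hiff := hp.greedyFirstChild_le_and_lt_iff hkey hroot hpar hdeg
  rw [greedyTree, SimpleGraph.fromRel_adj]
  simp only [Equiv.trans_apply, finCongr_apply, Fin.val_cast, keyEquiv_val, hiff, ne_eq,
    EmbeddingLike.apply_eq_iff_eq, Fin.cast_inj]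
  constructor
  · rintro ⟨-, ⟨h, rfl⟩ | ⟨h, rfl⟩⟩
    · exact hp.adj _ h
    · exact (hp.adj _ h).symm
  · exact fun h => ⟨h.ne, hp.parent_eq_of_adj u w h⟩

end IsParentMap

end Greedy

theorem theorem2p3 (ρ : FinRootedTree.{u} → ℝ) (hρ : IsRootedTreeInvariant ρ)
    (f : Multiset ℝ → ℝ) (hrec : HasRecurrenceRule ρ f) (hf : IsStrictlyIncreasingRule ρ f)
    (hmin : ∀ A B : FinRootedTree.{u}, Nat.card A.V = 1 → 1 < Nat.card B.V → ρ A < ρ B)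
    {V : Type u} [Fintype V] (T : SimpleGraph V) [DecidableRel T.Adj] (hT : T.IsTree)
    (hext : IsExchangeExtremal ρ hT) :
    Nonempty (T ≃g greedyTree (degreeSequence T)) := by
  have hb := hext.exchangeOrdered hρ hrec hf hmin
  obtain ⟨r, hr⟩ := exists_sink hT (branchValue ρ hT)
  obtain ⟨p, hp⟩ := hT.exists_isParentMap r
  have hup : ∀ e, e ≠ r → branchValue ρ hT (p e) e ≤ branchValue ρ hT e (p e) := fun e he =>
    hp.branch_le_of_sink hT hb hr _ e (hp.depth_eq e he)
  exact hp.nonempty_iso_greedyTree hp.breadthFirstKey_injective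
    (fun _ => hp.breadthFirstKey_root_lt) (fun _ _ => hp.breadthFirstKey_parent_le)
    fun _ _ => hp.degree_le_of_breadthFirstKey_lt hT hb hup
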